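/- Let $G$ be a locally compact group with right Haar measure $\mu_r$, and let $\pi$ be an irreducible (strongly continuous) unitary representation of $G$ on a complex Hilbert space $\mathcal H$. For $\phi,\psi\in\mathcal H$ let $\mathcal W_\phi\psi(x)=\langle\psi,\pi(x)^*\phi\rangle$, $x\in G$, be the wavelet transform, and let $\mathcal W_\phi(\mathcal H)=\{\mathcal W_\phi\psi:\psi\in\mathcal H\}$ be the wavelet space of $\phi$. Call $\phi$ admissible if $\mathcal W_\phi\phi\in L^2(G,\mu_r)$, that is, if $\phi$ lies in the domain of the Duflo--Moore operator of $\pi$, and assume that $\pi$ is square integrable, i.e. that a non-zero admissible vector exists. Let $\phi_1,\phi_2\in\mathcal H$ be admissible. If there is a non-zero $c\in\mathbb C$ such that $\phi_1=c\phi_2$, then $\mathcal W_{\phi_1}(\mathcal H)=\mathcal W_{\phi_2}(\mathcal H)$. Otherwise, $\mathcal W_{\phi_1}(\mathcal H)\cap\mathcal W_{\phi_2}(\mathcal H)=\{0\}$. -/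

import Mathlib

open MeasureTheory
open scoped ComplexConjugate

/-- A unitary representation of a topological group `G` on a complex Hilbert space `H`:
a strongly continuous homomorphism from `G` to the group of unitary operators on `H`. -/
structure UnitaryRep (G H : Type*) [Group G] [TopologicalSpace G]
    [NormedAddCommGroup H] [InnerProductSpace ℂ H] [CompleteSpace H] where
  /-- the underlying homomorphism -/
  hom : G →* unitary (H →L[ℂ] H)
  continuous_apply : ∀ ψ : H, Continuous fun x : G => (hom x : H →L[ℂ] H) ψ

namespace UnitaryRep

variable {G H : Type*} [Group G] [TopologicalSpace G]
    [NormedAddCommGroup H] [InnerProductSpace ℂ H] [CompleteSpace H]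

/-- The operator `π(x)` on `H`. -/
noncomputable def op (π : UnitaryRep G H) (x : G) : H →L[ℂ] H := (π.hom x : H →L[ℂ] H)

/-- `π` is (topologically) irreducible: `H ≠ 0`, and the only closed subspaces of `H` that are
invariant under all `π(x)` are `0` and `H`. -/
def IsIrreducible (π : UnitaryRep G H) : Prop :=
  Nontrivial H ∧ ∀ K : Submodule ℂ H, IsClosed (K : Set H) →
    (∀ x : G, ∀ v ∈ K, π.op x v ∈ K) → K = ⊥ ∨ K = ⊤

/-- The wavelet transform `W_φ ψ (x) = ⟨ψ, π(x)^* φ⟩`, where `⟨·,·⟩` is linear in its first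
argument (Mathlib's `inner` is linear in the second one), as a linear map in `ψ`. -/
noncomputable def wavelet (π : UnitaryRep G H) (φ : H) : H →ₗ[ℂ] (G → ℂ) where
  toFun ψ := fun x => inner ℂ (ContinuousLinearMap.adjoint (π.op x) φ) ψ
  map_add' ψ₁ ψ₂ := by
    funext x
    simp only [Pi.add_apply, inner_add_right]
  map_smul' a ψ := by
    funext x
    simp only [Pi.smul_apply, inner_smul_right, RingHom.id_apply, smul_eq_mul]

/-- The wavelet space `W_φ(H) = {W_φ ψ : ψ ∈ H}`, a space of functions on `G`. -/
noncomputable def waveletSpace (π : UnitaryRep G H) (φ : H) : Submodule ℂ (G → ℂ) :=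
  LinearMap.range (π.wavelet φ)

variable [MeasurableSpace G]

/-- `φ` is admissible (with respect to the right Haar measure `μ`): `W_φ φ` is square integrable.
For an irreducible `π` these are exactly the vectors in the domain of the Duflo-Moore operator. -/
def IsAdmissible (π : UnitaryRep G H) (μ : Measure G) (φ : H) : Prop :=
  MemLp (π.wavelet φ φ) 2 μ

/-- `π` is square integrable: there is a non-zero `φ` with `W_φ φ ∈ L²(μ)`. -/
def IsSquareIntegrable (π : UnitaryRep G H) (μ : Measure G) : Prop :=
  ∃ φ : H, φ ≠ 0 ∧ π.IsAdmissible μ φ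

/-- `D` has the defining properties of the Duflo-Moore operator: it is a densely defined
positive operator such that, for `φ₁, φ₂` in its domain and `ψ₁, ψ₂` in `H`,
`⟨W_φ₁ ψ₁, W_φ₂ ψ₂⟩_{L²(μ)} = ⟨ψ₁, ψ₂⟩ * conj ⟨D φ₁, D φ₂⟩`. -/
structure IsDufloMoore (π : UnitaryRep G H) (μ : Measure G) (D : H →ₗ.[ℂ] H) : Prop where
  dense : Dense (D.domain : Set H)
  positive : ∀ φ : D.domain, 0 ≤ (inner ℂ (φ : H) (D φ)).re ∧ (inner ℂ (φ : H) (D φ)).im = 0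
  memLp : ∀ (φ : D.domain) (ψ : H), MemLp (π.wavelet φ ψ) 2 μ
  orthogonality : ∀ (φ₁ φ₂ : D.domain) (ψ₁ ψ₂ : H),
    ∫ x, π.wavelet φ₁ ψ₁ x * conj (π.wavelet φ₂ ψ₂ x) ∂μ
      = inner ℂ ψ₂ ψ₁ * conj (inner ℂ (D φ₂) (D φ₁))

/-- Every vector in the domain of the Duflo-Moore operator is admissible, so that a statement
about all admissible vectors covers all of that domain. -/
theorem IsDufloMoore.isAdmissible {π : UnitaryRep G H} {μ : Measure G} {D : H →ₗ.[ℂ] H}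
    (hD : π.IsDufloMoore μ D) {φ : H} (hφ : φ ∈ D.domain) : π.IsAdmissible μ φ :=
  hD.memLp ⟨φ, hφ⟩ φ

end UnitaryRep

namespace UnitaryRep

open scoped ComplexStarModule

variable {G H : Type*} [Group G] [TopologicalSpace G]
    [NormedAddCommGroup H] [InnerProductSpace ℂ H] [CompleteSpace H]

/-! Nonzero scaling of `φ` only rescales its wavelet transform. For non-proportional `φ₁`, `φ₂`, the
pairs with `W_φ₁ ψ₁ = W_φ₂ ψ₂` form a closed subspace `K` of `H ⊕ H`, invariant under the diagonal
action. By Schur's lemma the projection `P` onto `K` is a 2 × 2 scalar matrix. Evaluating at the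
identity of `G` shows `(φ₁, -φ₂) ⟂ K`, so both rows of `P` give linear relations between `φ₁` and
`φ₂`. These must be trivial, hence `P = 0` and `K = 0`. -/

theorem op_mul (π : UnitaryRep G H) (x y : G) : π.op (x * y) = π.op x * π.op y := by
  simp [op]

theorem op_one (π : UnitaryRep G H) : π.op 1 = 1 := by
  simp [op]

theorem star_op (π : UnitaryRep G H) (x : G) : star (π.op x) = π.op x⁻¹ := by
  simp only [op, map_inv, ← Unitary.star_eq_inv, Unitary.coe_star]

theorem inner_op_left (π : UnitaryRep G H) (x : G) (v w : H) :
    inner ℂ (π.op x v) w = inner ℂ v (π.op x⁻¹ w) := by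
  rw [← star_op, ContinuousLinearMap.star_eq_adjoint, ContinuousLinearMap.adjoint_inner_right]

theorem wavelet_apply (π : UnitaryRep G H) (φ ψ : H) (x : G) :
    π.wavelet φ ψ x = inner ℂ φ (π.op x ψ) :=
  ContinuousLinearMap.adjoint_inner_left _ _ _

/-- If two operators have product zero and the left one commutes with an irreducible
representation, then one of them vanishes. -/
theorem IsIrreducible.eq_zero_or_eq_zero_of_mul_eq_zero {π : UnitaryRep G H}
    (hirr : π.IsIrreducible) {A B : H →L[ℂ] H} (hA : ∀ x, Commute A (π.op x))
    (hAB : A * B = 0) : A = 0 ∨ B = 0 := by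
  have hinv (x : G) (v : H) (hv : v ∈ LinearMap.ker A.toLinearMap) :
      π.op x v ∈ LinearMap.ker A.toLinearMap := by
    have hv' : A v = 0 := hv
    have := DFunLike.congr_fun (hA x) v
    change A (π.op x v) = 0
    simpa [hv'] using this
  rcases hirr.2 (LinearMap.ker A.toLinearMap) A.isClosed_ker hinv with h | h
  · right
    ext v
    have hv : B v ∈ LinearMap.ker A.toLinearMap := DFunLike.congr_fun hAB v
    rw [h] at hv
    exact hv
  · left
    ext v
    have hv : v ∈ LinearMap.ker A.toLinearMap := h ▸ Submodule.mem_top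
    exact hv

/-- **Schur's lemma** for self-adjoint operators. -/
theorem IsIrreducible.exists_eq_smul_one_of_isSelfAdjoint {π : UnitaryRep G H}
    (hirr : π.IsIrreducible) {A : H →L[ℂ] H} (hsa : IsSelfAdjoint A)
    (hA : ∀ x, Commute A (π.op x)) : ∃ r : ℝ, A = r • (1 : H →L[ℂ] H) := by
  have := hirr.1
  obtain ⟨r, hr⟩ := ContinuousFunctionalCalculus.spectrum_nonempty (R := ℝ) A hsa
  -- The spectrum is one point: for `s < t`, the ramps to the left and right of the midpoint have
  -- product zero, yet neither vanishes on the spectrum.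
  have key : ∀ s ∈ spectrum ℝ A, ∀ t ∈ spectrum ℝ A, ¬ s < t := by
    intro s hs t ht hst
    set m := (s + t) / 2 with hm
    have hf : Continuous fun u : ℝ => max (m - u) 0 := by fun_prop
    have hg : Continuous fun u : ℝ => max (u - m) 0 := by fun_prop
    have hmul : cfc (fun u : ℝ => max (m - u) 0) A * cfc (fun u : ℝ => max (u - m) 0) A = 0 := by
      rw [← cfc_mul _ _ A hf.continuousOn hg.continuousOn]
      have : (fun u : ℝ => max (m - u) 0 * max (u - m) 0) = fun _ => 0 := by
        funext u
        rcases le_total u m with h | h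
        · rw [max_eq_right (sub_nonpos.2 h), mul_zero]
        · rw [max_eq_right (sub_nonpos.2 h), zero_mul]
      rw [this, cfc_const_zero]
    have hcomm (x : G) : Commute (cfc (fun u : ℝ => max (m - u) 0) A) (π.op x) :=
      hsa.commute_cfc (hA x) _
    rcases hirr.eq_zero_or_eq_zero_of_mul_eq_zero hcomm hmul with h | h
    · have := eqOn_of_cfc_eq_cfc (h.trans (cfc_const_zero ℝ A).symm) hf.continuousOn
        continuousOn_const hsa hs
      have := (le_max_left (m - s) 0).trans_eq this
      linarith
    · have := eqOn_of_cfc_eq_cfc (h.trans (cfc_const_zero ℝ A).symm) hg.continuousOn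
        continuousOn_const hsa ht
      have := (le_max_left (t - m) 0).trans_eq this
      linarith
  refine ⟨r, ?_⟩
  have hid : cfc (fun u : ℝ => u) A = cfc (fun _ : ℝ => r) A :=
    cfc_congr fun s hs => le_antisymm (not_lt.1 (key r hr s hs)) (not_lt.1 (key s hs r hr))
  rwa [cfc_id' ℝ A hsa, cfc_const r A hsa, Algebra.algebraMap_eq_smul_one] at hid

/-- **Schur's lemma**: a bounded operator commuting with an irreducible unitary representation
is scalar. -/
theorem IsIrreducible.exists_eq_smul_one {π : UnitaryRep G H} (hirr : π.IsIrreducible)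
    {A : H →L[ℂ] H} (hA : ∀ x, Commute A (π.op x)) : ∃ c : ℂ, A = c • (1 : H →L[ℂ] H) := by
  have hstar (x : G) : Commute (star A) (π.op x) := by
    simpa [star_op] using (hA x⁻¹).star_star
  have hre (x : G) : Commute (ℜ A : H →L[ℂ] H) (π.op x) := by
    rw [realPart_apply_coe]
    exact ((hA x).add_left (hstar x)).smul_left _
  have him (x : G) : Commute (ℑ A : H →L[ℂ] H) (π.op x) := by
    rw [imaginaryPart_apply_coe]
    exact (((hA x).sub_left (hstar x)).smul_left _).smul_left _
  obtain ⟨r, hr⟩ := hirr.exists_eq_smul_one_of_isSelfAdjoint (ℜ A).2 hre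
  obtain ⟨s, hs⟩ := hirr.exists_eq_smul_one_of_isSelfAdjoint (ℑ A).2 him
  refine ⟨r + Complex.I * s, ?_⟩
  rw [← realPart_add_I_smul_imaginaryPart A, hr, hs, add_smul, mul_smul,
    Complex.coe_smul, Complex.coe_smul]

/-- The diagonal action of `π` on the Hilbert sum `H ⊕ H`. -/
noncomputable def diagonalOp (π : UnitaryRep G H) (x : G) (w : WithLp 2 (H × H)) :
    WithLp 2 (H × H) :=
  WithLp.toLp 2 (π.op x w.fst, π.op x w.snd)

/-- The orthogonal projection onto a closed invariant subspace of `H ⊕ H` commutes with the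
diagonal action. -/
theorem starProjection_diagonalOp (π : UnitaryRep G H) (K : Submodule ℂ (WithLp 2 (H × H)))
    [K.HasOrthogonalProjection] (hK : ∀ x, ∀ w ∈ K, π.diagonalOp x w ∈ K) (x : G)
    (w : WithLp 2 (H × H)) :
    K.starProjection (π.diagonalOp x w) = π.diagonalOp x (K.starProjection w) := by
  refine Submodule.eq_starProjection_of_mem_of_inner_eq_zero
    (hK x _ (K.starProjection_apply_mem w)) fun v hv => ?_
  -- Unitarity moves `π(x)` onto `v` as `π(x⁻¹)`, and `K` is invariant under that too.
  have h := K.starProjection_inner_eq_zero w _ (hK x⁻¹ v hv)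
  simp only [WithLp.prod_inner_apply, diagonalOp, WithLp.ofLp_sub, Prod.fst_sub, Prod.snd_sub,
    ← map_sub, inner_op_left] at h ⊢
  exact h

/-- The closed invariant subspace of pairs `(ψ₁, ψ₂)` with `W_φ₁ ψ₁ = W_φ₂ ψ₂`. -/
noncomputable def coincidence (π : UnitaryRep G H) (φ₁ φ₂ : H) :
    Submodule ℂ (WithLp 2 (H × H)) where
  carrier := {w | ∀ x, inner ℂ φ₁ (π.op x w.fst) = inner ℂ φ₂ (π.op x w.snd)}
  zero_mem' x := by simp
  add_mem' ha hb x := by simp [ha x, hb x]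
  smul_mem' c w hw x := by simp [hw x]

theorem isClosed_coincidence (π : UnitaryRep G H) (φ₁ φ₂ : H) :
    IsClosed (π.coincidence φ₁ φ₂ : Set (WithLp 2 (H × H))) := by
  have : (π.coincidence φ₁ φ₂ : Set (WithLp 2 (H × H))) =
      ⋂ x, {w | inner ℂ φ₁ (π.op x w.fst) = inner ℂ φ₂ (π.op x w.snd)} := by
    ext w
    simp [coincidence]
  rw [this]
  refine isClosed_iInter fun x => isClosed_eq ?_ ?_
  · exact continuous_const.inner
      ((π.op x).continuous.comp (WithLp.fstL 2 ℂ H H).continuous)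
  · exact continuous_const.inner
      ((π.op x).continuous.comp (WithLp.sndL 2 ℂ H H).continuous)

/-- Acting by `π(x)` right-translates both wavelet transforms. -/
theorem diagonalOp_mem_coincidence (π : UnitaryRep G H) (φ₁ φ₂ : H) (x : G)
    (w : WithLp 2 (H × H)) (hw : w ∈ π.coincidence φ₁ φ₂) :
    π.diagonalOp x w ∈ π.coincidence φ₁ φ₂ := by
  intro y
  have := hw (y * x)
  simpa [op_mul, diagonalOp] using this

/-- For an irreducible representation, the orthogonal projection onto a closed invariant subspace
of `H ⊕ H` is a `2 × 2` matrix of scalars. -/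
theorem IsIrreducible.exists_starProjection_eq {π : UnitaryRep G H} (hirr : π.IsIrreducible)
    (K : Submodule ℂ (WithLp 2 (H × H))) [K.HasOrthogonalProjection]
    (hK : ∀ x, ∀ w ∈ K, π.diagonalOp x w ∈ K) :
    ∃ a b c d : ℂ, ∀ u v : H, K.starProjection (WithLp.toLp 2 (u, v)) =
      WithLp.toLp 2 (a • u + b • v, c • u + d • v) := by
  let e := (WithLp.prodContinuousLinearEquiv 2 ℂ H H).symm
  let i₁ : H →L[ℂ] WithLp 2 (H × H) := e.toContinuousLinearMap ∘L ContinuousLinearMap.inl ℂ H H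
  let i₂ : H →L[ℂ] WithLp 2 (H × H) := e.toContinuousLinearMap ∘L ContinuousLinearMap.inr ℂ H H
  have h₁ (x : G) (u : H) : i₁ (π.op x u) = π.diagonalOp x (i₁ u) := by
    simp [i₁, e, diagonalOp]
  have h₂ (x : G) (u : H) : i₂ (π.op x u) = π.diagonalOp x (i₂ u) := by
    simp [i₂, e, diagonalOp]
  -- Each component of the projection after an intertwiner `i` commutes with `π`, so Schur applies.
  have scalar (i : H →L[ℂ] WithLp 2 (H × H))
      (hi : ∀ x u, i (π.op x u) = π.diagonalOp x (i u)) :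
      ∃ a c : ℂ, ∀ u, K.starProjection (i u) = WithLp.toLp 2 (a • u, c • u) := by
    obtain ⟨a, ha⟩ := hirr.exists_eq_smul_one (A := WithLp.fstL 2 ℂ H H ∘L K.starProjection ∘L i)
      fun x => by
        ext u
        simp only [mul_apply_eq_comp, ContinuousLinearMap.comp_apply, hi,
          starProjection_diagonalOp π K hK]
        rfl
    obtain ⟨c, hc⟩ := hirr.exists_eq_smul_one (A := WithLp.sndL 2 ℂ H H ∘L K.starProjection ∘L i)
      fun x => by
        ext u
        simp only [mul_apply_eq_comp, ContinuousLinearMap.comp_apply, hi,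
          starProjection_diagonalOp π K hK]
        rfl
    refine ⟨a, c, fun u => ?_⟩
    have hau := DFunLike.congr_fun ha u
    have hcu := DFunLike.congr_fun hc u
    exact (WithLp.ofLp_injective 2) (Prod.ext hau hcu)
  obtain ⟨a, c, hac⟩ := scalar i₁ h₁
  obtain ⟨b, d, hbd⟩ := scalar i₂ h₂
  refine ⟨a, b, c, d, fun u v => ?_⟩
  have huv : WithLp.toLp 2 (u, v) = i₁ u + i₂ v := by
    apply WithLp.ofLp_injective 2
    simp [i₁, i₂, e]
  rw [huv, map_add, hac, hbd, ← WithLp.toLp_add, Prod.mk_add_mk]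

theorem waveletSpace_smul (π : UnitaryRep G H) {c : ℂ} (hc : c ≠ 0) (φ : H) :
    π.waveletSpace (c • φ) = π.waveletSpace φ := by
  have h : π.wavelet (c • φ) = conj c • π.wavelet φ := by
    ext ψ x
    simp [wavelet_apply, mul_comm]
  rw [waveletSpace, h, LinearMap.range_smul _ _ (by simpa using hc), waveletSpace]

/-- Wavelet spaces of non-proportional vectors of an irreducible representation meet only in
zero. -/
theorem IsIrreducible.waveletSpace_inf_eq_bot {π : UnitaryRep G H} (hirr : π.IsIrreducible)
    {φ₁ φ₂ : H} (h : ¬ ∃ c : ℂ, c ≠ 0 ∧ φ₁ = c • φ₂) :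
    π.waveletSpace φ₁ ⊓ π.waveletSpace φ₂ = ⊥ := by
  rw [eq_bot_iff]
  rintro f ⟨⟨ψ₁, rfl⟩, ⟨ψ₂, hψ⟩⟩
  rw [Submodule.mem_bot]
  -- A zero vector can be non-proportional in the sense of `h` without being linearly independent,
  -- but its wavelet space is zero.
  by_cases h₁ : φ₁ = 0
  · funext x
    simp [wavelet_apply, h₁]
  by_cases h₂ : φ₂ = 0
  · rw [← hψ]
    funext x
    simp [wavelet_apply, h₂]
  have proportional {a b : ℂ} (hab : a • φ₁ = b • φ₂) : a = 0 ∧ b = 0 := by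
    have ha : a = 0 := by
      by_contra ha
      have hb : b ≠ 0 := by
        rintro rfl
        simp [ha, h₁] at hab
      exact h ⟨a⁻¹ * b, mul_ne_zero (inv_ne_zero ha) hb, by
        rw [mul_smul, ← hab, inv_smul_smul₀ ha]⟩
    refine ⟨ha, ?_⟩
    simpa [ha, h₂] using hab.symm
  let K := π.coincidence φ₁ φ₂
  have : CompleteSpace K := (π.isClosed_coincidence φ₁ φ₂).completeSpace_coe
  obtain ⟨a, b, c, d, hP⟩ :=
    hirr.exists_starProjection_eq K (π.diagonalOp_mem_coincidence φ₁ φ₂)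
  have hφ : WithLp.toLp 2 (φ₁, -φ₂) ∈ Kᗮ := by
    rw [Submodule.mem_orthogonal']
    intro w hw
    have := hw 1
    simp only [op_one, one_apply_eq_self] at this
    simpa [WithLp.prod_inner_apply, inner_neg_left, add_neg_eq_zero] using this
  have hφ0 := K.starProjection_apply_eq_zero_iff.2 hφ
  rw [hP] at hφ0
  -- The two components read `a • φ₁ = b • φ₂` and `c • φ₁ = d • φ₂`.
  have h0 := congrArg WithLp.ofLp hφ0
  simp only [WithLp.ofLp_zero, Prod.mk_eq_zero, smul_neg, add_neg_eq_zero] at h0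
  obtain ⟨rfl, rfl⟩ := proportional h0.1
  obtain ⟨rfl, rfl⟩ := proportional h0.2
  have hψK : WithLp.toLp 2 (ψ₁, ψ₂) ∈ K := fun x => by
    simpa [wavelet_apply] using (congrFun hψ x).symm
  have hψ0 := K.starProjection_eq_self_iff.2 hψK
  rw [hP] at hψ0
  have hψ₁ : ψ₁ = 0 := by simpa using (congrArg WithLp.fst hψ0).symm
  rw [hψ₁, map_zero]

end UnitaryRep

theorem mainTheorem11 {G H : Type*} [Group G] [TopologicalSpace G] [IsTopologicalGroup G]
    [LocallyCompactSpace G] [MeasurableSpace G] [BorelSpace G]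
    [NormedAddCommGroup H] [InnerProductSpace ℂ H] [CompleteSpace H]
    (μ : Measure G) [μ.IsMulRightInvariant] [μ.IsOpenPosMeasure] [μ.Regular]
    (π : UnitaryRep G H) (hirr : π.IsIrreducible) (hsq : π.IsSquareIntegrable μ)
    (φ₁ φ₂ : H) (hφ₁ : π.IsAdmissible μ φ₁) (hφ₂ : π.IsAdmissible μ φ₂) :
    ((∃ c : ℂ, c ≠ 0 ∧ φ₁ = c • φ₂) → π.waveletSpace φ₁ = π.waveletSpace φ₂) ∧
    ((¬ ∃ c : ℂ, c ≠ 0 ∧ φ₁ = c • φ₂) → π.waveletSpace φ₁ ⊓ π.waveletSpace φ₂ = ⊥) := by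
  refine ⟨?_, hirr.waveletSpace_inf_eq_bot⟩
  rintro ⟨c, hc, rfl⟩
  exact π.waveletSpace_smul hc φ₂
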